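/- **Setting.** Let $G=(V,E)$ be a finite undirected graph with $m=|E|\ge 1$ edges and edge capacities $c(e)$ such that $C:=\min_e c(e)>1$, and let $N$ be a finite, linearly ordered set of firms with demands $d(i)\in[0,1]$. For each firm $i$ let $\mathcal S_i$ be a nonempty family of admissible routes (edge sets): in *unicast* routing the paths in $G$ between two given terminals $s_i,t_i$; in *multicast* routing the Steiner trees in $G$, i.e. the subtrees that contain a given source and a given set of further terminals of firm $i$. In the network bandwidth reallocation problem, given values $v(i)\ge 0$, one seeks a set $R\subseteq N$ of maximum total value $\sum_{i\in R}v(i)$ which is feasible, i.e. for which there are routes $T_i\in\mathcal S_i$ ($i\in R$) with $\sum_{i\in R:\,e\in T_i}d(i)\le c(e)$ for every $e\in E$. Fix a deterministic subroutine that returns, for every firm $i$ and all positive edge weights $y$, a route $S_i=S_i(y)\in\mathcal S_i$ with $\sum_{e\in S_i}y(e)\le\gamma\min_{S\in\mathcal S_i}\sum_{e\in S}y(e)$, where $\gamma=1$ (an exact shortest path) in the unicast case and $\gamma=1.55$ (a $1.55$-approximate minimum weight Steiner tree) in the multicast case. **Algorithm (Briest et al.).** Start with $N'=N$ and $y(e)=1/c(e)$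 for all $e$. While $N'\neq\emptyset$ and $\sum_e c(e)y(e)<\bar e^{\,C-1}m$ (with $\bar e$ Euler's number): compute $S_i=S_i(y)$ for $i\in N'$; let $i\in N'$ maximize $\frac{v(i)}{d(i)\sum_{e\in S_i}y(e)}$ (ties are broken by lowest index; a quotient with zero denominator is $\infty$ if $v(i)>0$ and $0$ if $v(i)=0$); select $i$ with the route $S_i$, remove $i$ from $N'$, and multiply $y(e)$ by $(\bar e^{\,C-1}m)^{d(i)/(c(e)-1)}$ for each $e\in S_i$. Return the selected firms $N\setminus N'$ and their routes. **Theorem.** In both cases the following holds. (a) *(DA-implementability.)* There are scoring functions $s^A_i(b,u)\in[0,\infty]$ ($A\subseteq N$, $i\in A$, $b\ge0$, $u\in\mathbb R_{\ge0}^{N\setminus A}$), nondecreasing in $b$, such that whenever the algorithm, run on values $v$, is in a state with $N'=A$ and dual variables $y$, then for all $i\in A$ and $b\ge 0$ $$s^A_i(b,v_{N\setminus A})=\frac{b}{d(i)\sum_{e\in S_i(y)}y(e)}$$ if the while-loop is running, and $s^A_i(b,v_{N\setminus A})=0$ if it has ended. They implement the algorithm with active set $A=N'$, which is initially $N$: every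 iteration removes from $A$ the (lowest indexed) element $i\in A$ of highest score $s^A_i(v(i),v_{N\setminus A})$; when the algorithm has stopped, all scores of elements of $A$ are $0$; and if all these scores are $0$, then the algorithm has stopped, or all $v(i)$, $i\in A$, are zero (for positive values, therefore, the algorithm stops if and only if all the scores are $0$). (b) *(Approximation.)* For all values $v\ge 0$ the algorithm stops after at most $|N|$ iterations, the selected firms with their routes are feasible, and their total value is at least $$\left(\frac{\bar e\,\gamma\, C}{C-1}\,m^{1/(C-1)}\right)^{-1}$$ times the total value of every feasible set of firms. -/

import Mathlib

open scoped NNReal ENNReal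

namespace BandwidthAuction

/-! ### Greedy algorithms, scoring functions and deferred-acceptance implementability -/

/-- The lowest indexed maximizer of `f` on a nonempty finite set `A`. -/
noncomputable def firstArgmax {N : Type*} [LinearOrder N] (A : Finset N) (f : N → ℝ≥0∞)
    (hA : A.Nonempty) : N :=
  (A.filter (fun i => ∀ j ∈ A, f j ≤ f i)).min' (by
    obtain ⟨i, hi, hmax⟩ := A.exists_max_image f hA
    exact ⟨i, Finset.mem_filter.2 ⟨hi, hmax⟩⟩)

/-- A family of scoring functions `s^A_i(b_i, b_{N ∖ A})`: the score of `i` at the active set `A` is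
a function of `i`'s own bid and of the bids of the inactive elements only. Scores are extended
nonnegative reals, the value `∞` being that of a quotient of a positive number by `0`. -/
def ScoringFamily (N : Type*) : Type _ :=
  (A : Finset N) → N → ℝ≥0 → ({j : N // j ∉ A} → ℝ≥0) → ℝ≥0∞

/-- The score `s^A_i(w_i, w_{N ∖ A})` for a weight vector `w`. -/
def ScoringFamily.eval {N : Type*} (s : ScoringFamily N) (A : Finset N) (w : N → ℝ≥0) (i : N) :
    ℝ≥0∞ :=
  s A i (w i) (fun j => w j)

/-- A forward greedy algorithm on the element set `N` (a single while-loop): its states, the set of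
elements not yet selected in a state, the initial state, the condition of the while-loop, and the
body of the loop. The last two may use the weights. The solution returned from the final state `σ`
selects the elements outside `active σ`. -/
structure GreedyAlgorithm (N : Type*) where
  /-- contents of the memory between two iterations -/
  State : Type*
  /-- the elements not yet selected -/
  active : State → Finset N
  /-- the state before the first iteration -/
  init : State
  /-- the condition of the while-loop -/
  running : (N → ℝ≥0) → State → Prop
  /-- the body of the while-loop -/
  body : (N → ℝ≥0) → State → State

open Classical in
/-- The state after `k` rounds; once the condition of the while-loop fails the state is kept. -/
noncomputable def GreedyAlgorithm.run {N : Type*} (alg : GreedyAlgorithm N) (w : N → ℝ≥0)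
    (k : ℕ) : alg.State :=
  (fun σ => if alg.running w σ then alg.body w σ else σ)^[k] alg.init

/-- The scoring functions `s` implement the greedy algorithm `alg`: they are nondecreasing in the own
bid, the active set starts as `N`, every iteration removes from the active set its (lowest indexed)
element of highest score, and the algorithm stops exactly when all scores of active elements
vanish. For the last item elements of weight zero need care, since an algorithm may go on to select
elements that are worth nothing: stopping at vanishing scores is asked for unless all remaining
weights are zero. For positive weights the last two clauses say that the algorithm has stopped
if and only if all the scores of active elements are zero (if it has not stopped, the active set is
nonempty). -/
def DAImplements {N : Type*} [Fintype N] [LinearOrder N] (s : ScoringFamily N)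
    (alg : GreedyAlgorithm N) : Prop :=
  (∀ (A : Finset N) (i : N) (u : {j : N // j ∉ A} → ℝ≥0), Monotone (fun b => s A i b u)) ∧
  alg.active alg.init = Finset.univ ∧
  ∀ (w : N → ℝ≥0) (k : ℕ),
    (alg.running w (alg.run w k) →
      ∃ h : (alg.active (alg.run w k)).Nonempty,
        alg.active (alg.run w (k + 1)) =
          (alg.active (alg.run w k)).erase
            (firstArgmax (alg.active (alg.run w k)) (s.eval (alg.active (alg.run w k)) w) h)) ∧
    (¬ alg.running w (alg.run w k) →
      ∀ i ∈ alg.active (alg.run w k), s.eval (alg.active (alg.run w k)) w i = 0) ∧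
    ((∀ i ∈ alg.active (alg.run w k), s.eval (alg.active (alg.run w k)) w i = 0) →
      ¬ alg.running w (alg.run w k) ∨ ∀ i ∈ alg.active (alg.run w k), w i = 0)

/-! ### The routing problem -/

/-- A routing problem for firms `N` on a network with edges `E`: edge capacities, demands, and for
each firm `i` the family `𝒮_i` of edge sets that connect its terminals. -/
structure RoutingProblem (N E : Type*) where
  /-- the capacities `c(e)` -/
  cap : E → ℝ
  /-- the demands `d(i)` -/
  demand : N → ℝ
  /-- the admissible routes `𝒮_i` of firm `i` -/
  routes : N → Set (Finset E)

/-- Paths from `s` to `t` in `G`, as edge sets. -/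
def pathRoutes {V : Type*} (G : SimpleGraph V) (s t : V) : Set (Finset G.edgeSet) :=
  {S | ∃ p : G.Walk s t, p.IsPath ∧ ∀ e : G.edgeSet, e ∈ S ↔ (e : Sym2 V) ∈ p.edges}

/-- Steiner trees in `G` for the terminal set `K`, as edge sets: the edge sets of the subgraphs of
`G` that are trees and contain all terminals. -/
def steinerRoutes {V : Type*} (G : SimpleGraph V) (K : Set V) : Set (Finset G.edgeSet) :=
  {S | ∃ H : G.Subgraph, H.coe.IsTree ∧ K ⊆ H.verts ∧
    ∀ e : G.edgeSet, e ∈ S ↔ (e : Sym2 V) ∈ H.edgeSet}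

/-- Unicast routing: firm `i` wants to connect `s i` to `t i` by a path. -/
def unicast {V N : Type*} (G : SimpleGraph V) (cap : G.edgeSet → ℝ) (demand : N → ℝ)
    (s t : N → V) : RoutingProblem N G.edgeSet where
  cap := cap
  demand := demand
  routes i := pathRoutes G (s i) (t i)

/-- Multicast routing: firm `i` wants a tree containing its source and its other terminals. -/
def multicast {V N : Type*} (G : SimpleGraph V) (cap : G.edgeSet → ℝ) (demand : N → ℝ)
    (source : N → V) (sinks : N → Set V) : RoutingProblem N G.edgeSet where
  cap := cap
  demand := demand
  routes i := steinerRoutes G (insert (source i) (sinks i))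

namespace RoutingProblem

variable {N E : Type*} [Fintype E] [DecidableEq E]

/-- The minimum capacity `C = min_e c(e)` (it is `0` if there is no edge). -/
noncomputable def minCap (P : RoutingProblem N E) : ℝ := ⨅ e, P.cap e

/-- The firms in `R` can keep their rights: route `i ∈ R` along `T i`, within the capacities. -/
def IsFeasible (P : RoutingProblem N E) (R : Finset N) (T : N → Finset E) : Prop :=
  (∀ i ∈ R, T i ∈ P.routes i) ∧
  ∀ e : E, ∑ i ∈ R with e ∈ T i, P.demand i ≤ P.cap e

/-- A routing subroutine, which computes from a firm and positive edge weights an admissible route of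
weight at most `γ` times the minimum weight. For `γ = 1` it computes an `argmin`. -/
def IsRouter (P : RoutingProblem N E) (γ : ℝ) (router : N → (E → ℝ) → Finset E) : Prop :=
  ∀ (i : N) (y : E → ℝ), (∀ e, 0 < y e) →
    router i y ∈ P.routes i ∧
    ∀ S ∈ P.routes i, ∑ e ∈ router i y, y e ≤ γ * ∑ e ∈ S, y e

/-- The number `ē^(C-1) m`. -/
noncomputable def threshold (P : RoutingProblem N E) : ℝ :=
  Real.exp (P.minCap - 1) * Fintype.card E

/-- The quotient `b / (d(i) ∑_{e ∈ S_i} y(e))`, where `S_i` is the route which the subroutine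
computes for firm `i` and the weights `y`. It is `∞` if `b` is positive and the denominator is `0`,
and it is `0` if `b = 0`. -/
noncomputable def ratio (P : RoutingProblem N E) (router : N → (E → ℝ) → Finset E)
    (y : E → ℝ) (i : N) (b : ℝ≥0) : ℝ≥0∞ :=
  (b : ℝ≥0∞) / ENNReal.ofReal (P.demand i * ∑ e ∈ router i y, y e)

end RoutingProblem

/-! ### The primal-dual greedy routing algorithm -/

/-- A state of the routing algorithm. -/
structure RoutingState (N E : Type*) where
  /-- the set `N'` of the firms not yet selected -/
  active : Finset N
  /-- the dual variables `y(e)` -/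
  dual : E → ℝ
  /-- the routes of the selected firms (`∅` for the other firms, where it means nothing) -/
  route : N → Finset E

namespace RoutingProblem

variable {N E : Type*} [Fintype E] [DecidableEq E]

/-- The dual variables after firm `i` has been routed along `S`:
`y(e)` is multiplied by `(ē^(C-1) m)^(d(i) / (c(e) - 1))` for `e ∈ S`. -/
noncomputable def updateDual (P : RoutingProblem N E) (y : E → ℝ) (i : N) (S : Finset E) :
    E → ℝ :=
  fun e => if e ∈ S then y e * P.threshold ^ (P.demand i / (P.cap e - 1)) else y e

/-- Selection of firm `i` in state `σ`, which is routed along `router i σ.dual`. -/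
noncomputable def select [DecidableEq N] (P : RoutingProblem N E)
    (router : N → (E → ℝ) → Finset E) (σ : RoutingState N E) (i : N) : RoutingState N E where
  active := σ.active.erase i
  dual := P.updateDual σ.dual i (router i σ.dual)
  route := Function.update σ.route i (router i σ.dual)

/-- The primal-dual greedy algorithm of Briest, Krysta and Vöcking. -/
noncomputable def greedy [Fintype N] [LinearOrder N] (P : RoutingProblem N E)
    (router : N → (E → ℝ) → Finset E) : GreedyAlgorithm N where
  State := RoutingState N E
  active := RoutingState.active
  init := { active := Finset.univ, dual := fun e => 1 / P.cap e, route := fun _ => ∅ }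
  running := fun _ σ => σ.active.Nonempty ∧ ∑ e, P.cap e * σ.dual e < P.threshold
  body := fun v σ =>
    if h : σ.active.Nonempty then
      P.select router σ (firstArgmax σ.active (fun i => P.ratio router σ.dual i (v i)) h)
    else σ

open Classical in
/-- `s` is the family of scoring functions of the algorithm: whenever the algorithm, run on some
values `v`, is in a state with active set `A` and dual variables `y`, then for every active firm `i`
and every bid `b` of this firm, `s^A_i(b, v_{N ∖ A}) = b / (d(i) ∑_{e ∈ S_i} y(e))` with `S_i` the
route computed for `y`, as long as the while-loop is running, and the score is `0` if the while-loop
has ended. -/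
def IsGreedyScoring [Fintype N] [LinearOrder N] (P : RoutingProblem N E)
    (router : N → (E → ℝ) → Finset E) (s : ScoringFamily N) : Prop :=
  ∀ (v : N → ℝ≥0) (k : ℕ) (σ : RoutingState N E), σ = (P.greedy router).run v k →
    ∀ i ∈ σ.active, ∀ b : ℝ≥0,
      s σ.active i b (fun j => v j) =
        if (P.greedy router).running v σ then P.ratio router σ.dual i b else 0

/-- The greedy algorithm stops after at most `|N|` iterations, with a feasible solution whose value is
at least `α` times the value of every feasible solution. -/
def GreedyApproximates [Fintype N] [LinearOrder N] (P : RoutingProblem N E)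
    (router : N → (E → ℝ) → Finset E) (α : ℝ) : Prop :=
  ∀ v : N → ℝ≥0, ∃ (k : ℕ) (σ : RoutingState N E), k ≤ Fintype.card N ∧
    σ = (P.greedy router).run v k ∧ ¬ (P.greedy router).running v σ ∧
    P.IsFeasible (σ.active)ᶜ σ.route ∧
    ∀ (R : Finset N) (T : N → Finset E), P.IsFeasible R T →
      α * ∑ i ∈ R, (v i : ℝ) ≤ ∑ i ∈ (σ.active)ᶜ, (v i : ℝ)

/-- The approximation ratio `(ē γ C / (C - 1) · m^(1 / (C - 1)))⁻¹`. -/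
noncomputable def approxRatio (P : RoutingProblem N E) (γ : ℝ) : ℝ :=
  (Real.exp 1 * γ * P.minCap / (P.minCap - 1) *
    (Fintype.card E : ℝ) ^ (1 / (P.minCap - 1)))⁻¹

end RoutingProblem

end BandwidthAuction

open BandwidthAuction

/-! Scoring functions exist because a reachable state of the algorithm is determined by its active set
`A` and by the values outside `A` (`RoutingProblem.run_eq_run`): as long as two runs have selected only
firms outside `A`, each selection is a maximizer for both runs, because the values of both selected
firms agree, and so the lowest indexed maximizers coincide. The score can therefore be read off from
any run that reaches `A`.

The approximation guarantee is a primal-dual argument. The dual variables satisfy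
`c(e) y(e) = τ ^ (load(e) / (c(e) - 1))`, where `τ` is the threshold, so while the loop is running every
load is less than `c(e) - 1`, and one more demand (at most `1`) fits (`RoutingProblem.Invariant`). For
the value, put `κ = C (τ ^ (1 / (C - 1)) - 1)` and let `D = ∑ c(e) y(e)`. By Bernoulli's inequality,
selecting `i` increases `D` by at most `κ d(i) ∑_{e ∈ S_i} y(e)`. Since `i` maximizes the quotient and
the routes are `γ`-approximate, a feasible set whose not yet selected firms have total value at least
`Δ` forces `Δ (D' - D) ≤ κ γ v(i) D`, where `D'` is the value of `D` after the iteration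
(`RoutingProblem.value_mul_dual_increase_le`). Hence `D` grows by a factor of at most
`exp (κ γ v(i) / Δ)`, from `m` up to `τ = exp (C - 1) m` if the loop ends at the threshold; this bounds
`Δ`, the excess of the feasible set over the returned one, by `κ γ / (C - 1)` times the returned value
(`RoutingProblem.mul_value_le_of_threshold_le`). As `C - 1 ≤ C γ`, the factor `1 + κ γ / (C - 1)` is at
most `γ C τ ^ (1 / (C - 1)) / (C - 1)`, and `τ ^ (1 / (C - 1)) = ē m ^ (1 / (C - 1))`. -/

set_option linter.unusedSectionVars false

namespace BandwidthAuction

/-! ### Lowest indexed maximizers -/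

section FirstArgmax

variable {N : Type*} [LinearOrder N] {A : Finset N} {f g : N → ℝ≥0∞}

lemma firstArgmax_mem (hA : A.Nonempty) : firstArgmax A f hA ∈ A :=
  (Finset.mem_filter.1 (Finset.min'_mem (A.filter fun i => ∀ j ∈ A, f j ≤ f i) _)).1

lemma le_firstArgmax (hA : A.Nonempty) {j : N} (hj : j ∈ A) : f j ≤ f (firstArgmax A f hA) :=
  (Finset.mem_filter.1 (Finset.min'_mem (A.filter fun i => ∀ j ∈ A, f j ≤ f i) _)).2 j hj

lemma firstArgmax_le (hA : A.Nonempty) {i : N} (hi : i ∈ A) (h : ∀ j ∈ A, f j ≤ f i) :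
    firstArgmax A f hA ≤ i :=
  Finset.min'_le _ _ (Finset.mem_filter.2 ⟨hi, h⟩)

lemma firstArgmax_congr (hA : A.Nonempty) (h : ∀ i ∈ A, f i = g i) :
    firstArgmax A f hA = firstArgmax A g hA := by
  apply le_antisymm
  · refine firstArgmax_le hA (firstArgmax_mem hA) fun j hj => ?_
    rw [h j hj, h _ (firstArgmax_mem hA)]
    exact le_firstArgmax hA hj
  · refine firstArgmax_le hA (firstArgmax_mem hA) fun j hj => ?_
    rw [← h j hj, ← h _ (firstArgmax_mem hA)]
    exact le_firstArgmax hA hj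

/-- Two functions have the same first maximizer as soon as they agree at both of their first
maximizers, however they differ elsewhere. -/
lemma firstArgmax_eq_of_agree (hA : A.Nonempty)
    (hf : f (firstArgmax A f hA) = g (firstArgmax A f hA))
    (hg : f (firstArgmax A g hA) = g (firstArgmax A g hA)) :
    firstArgmax A f hA = firstArgmax A g hA := by
  have h1 : f (firstArgmax A g hA) ≤ f (firstArgmax A f hA) :=
    le_firstArgmax hA (firstArgmax_mem hA)
  have h2 : g (firstArgmax A f hA) ≤ g (firstArgmax A g hA) :=
    le_firstArgmax hA (firstArgmax_mem hA)
  apply le_antisymm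
  · refine firstArgmax_le hA (firstArgmax_mem hA) fun j hj => (le_firstArgmax hA hj).trans ?_
    rw [hf, hg]
    exact h2
  · refine firstArgmax_le hA (firstArgmax_mem hA) fun j hj => (le_firstArgmax hA hj).trans ?_
    rw [← hf, ← hg]
    exact h1

end FirstArgmax

open Classical in
lemma GreedyAlgorithm.run_succ {N : Type*} (alg : GreedyAlgorithm N) (w : N → ℝ≥0) (k : ℕ) :
    alg.run w (k + 1) =
      if alg.running w (alg.run w k) then alg.body w (alg.run w k) else alg.run w k :=
  Function.iterate_succ_apply' _ _ _

namespace RoutingProblem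

variable {N E : Type*} [Fintype E] [DecidableEq E]

/-! ### Runs of the greedy routing algorithm -/

section Run

variable [Fintype N] [LinearOrder N] (P : RoutingProblem N E) (router : N → (E → ℝ) → Finset E)

/-- The firm that an iteration started in the state `σ` selects. -/
noncomputable def selected (v : N → ℝ≥0) (σ : RoutingState N E) (h : σ.active.Nonempty) : N :=
  firstArgmax σ.active (fun i => P.ratio router σ.dual i (v i)) h

lemma run_succ_of_running {v : N → ℝ≥0} {k : ℕ}
    (h : (P.greedy router).running v ((P.greedy router).run v k)) :
    (P.greedy router).run v (k + 1) =
      P.select router ((P.greedy router).run v k)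
        (P.selected router v ((P.greedy router).run v k) h.1) := by
  rw [GreedyAlgorithm.run_succ, if_pos h]
  exact dif_pos h.1

lemma run_succ_of_not_running {v : N → ℝ≥0} {k : ℕ}
    (h : ¬ (P.greedy router).running v ((P.greedy router).run v k)) :
    (P.greedy router).run v (k + 1) = (P.greedy router).run v k := by
  rw [GreedyAlgorithm.run_succ, if_neg h]

lemma active_run_succ {v : N → ℝ≥0} {k : ℕ}
    (h : (P.greedy router).running v ((P.greedy router).run v k)) :
    RoutingState.active ((P.greedy router).run v (k + 1)) =
      (RoutingState.active ((P.greedy router).run v k)).erase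
        (P.selected router v ((P.greedy router).run v k) h.1) := by
  rw [run_succ_of_running P router h]
  rfl

lemma active_run_antitone (v : N → ℝ≥0) :
    Antitone fun k => RoutingState.active ((P.greedy router).run v k) := by
  refine antitone_nat_of_succ_le fun k => ?_
  by_cases h : (P.greedy router).running v ((P.greedy router).run v k)
  · simp only [active_run_succ P router h]
    exact Finset.erase_subset _ _
  · simp only [run_succ_of_not_running P router h]
    exact le_rfl

lemma active_run_card (v : N → ℝ≥0) (k : ℕ) :
    (P.greedy router).running v ((P.greedy router).run v k) →
      (RoutingState.active ((P.greedy router).run v k)).card + k = Fintype.card N := by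
  induction k with
  | zero => exact fun _ => Finset.card_univ
  | succ k ih =>
    intro h
    by_cases h' : (P.greedy router).running v ((P.greedy router).run v k)
    · have hm : P.selected router v ((P.greedy router).run v k) h'.1 ∈
          RoutingState.active ((P.greedy router).run v k) := firstArgmax_mem _
      have hpos := Finset.card_pos.2 ⟨_, hm⟩
      rw [active_run_succ P router h', Finset.card_erase_of_mem hm]
      have := ih h'
      omega
    · rw [run_succ_of_not_running P router h'] at h
      exact absurd h h'

lemma not_running_card (v : N → ℝ≥0) :
    ¬ (P.greedy router).running v ((P.greedy router).run v (Fintype.card N)) := by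
  intro h
  have h1 := P.active_run_card router v _ h
  have h2 := Finset.card_pos.2 h.1
  omega

/-! ### Scoring functions -/

/-- Two runs whose values agree outside `A` coincide for as long as both have selected only firms
outside `A`. -/
lemma run_eq_run_of_subset {A : Finset N} {v w : N → ℝ≥0} (hvw : ∀ j ∉ A, v j = w j) (k : ℕ) :
    A ⊆ RoutingState.active ((P.greedy router).run v k) →
    A ⊆ RoutingState.active ((P.greedy router).run w k) →
      (P.greedy router).run v k = (P.greedy router).run w k := by
  induction k with
  | zero => exact fun _ _ => rfl
  | succ k ih =>
    intro hv hw
    have hk := ih (hv.trans (P.active_run_antitone router v k.le_succ))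
      (hw.trans (P.active_run_antitone router w k.le_succ))
    by_cases h : (P.greedy router).running v ((P.greedy router).run v k)
    · have h' : (P.greedy router).running w ((P.greedy router).run w k) := hk ▸ h
      rw [active_run_succ P router h] at hv
      rw [active_run_succ P router h'] at hw
      have ev := hvw _ fun hm => Finset.notMem_erase _ _ (hv hm)
      have ew := hvw _ fun hm => Finset.notMem_erase _ _ (hw hm)
      rw [run_succ_of_running P router h, run_succ_of_running P router h']
      generalize (P.greedy router).run w k = σ at *
      subst hk
      congr 1
      exact firstArgmax_eq_of_agree h.1 (congrArg (P.ratio router _ _) ev)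
        (congrArg (P.ratio router _ _) ew)
    · have h' : ¬ (P.greedy router).running w ((P.greedy router).run w k) := hk ▸ h
      rw [run_succ_of_not_running P router h, run_succ_of_not_running P router h', hk]

lemma run_eq_of_active_eq (v : N → ℝ≥0) {k l : ℕ} (hkl : k ≤ l) :
    RoutingState.active ((P.greedy router).run v l) =
      RoutingState.active ((P.greedy router).run v k) →
    (P.greedy router).run v l = (P.greedy router).run v k := by
  induction l, hkl using Nat.le_induction with
  | base => exact fun _ => rfl
  | succ l hkl ih =>
    intro h
    have hl : RoutingState.active ((P.greedy router).run v l) =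
        RoutingState.active ((P.greedy router).run v k) :=
      Finset.Subset.antisymm (P.active_run_antitone router v hkl)
        (h.symm.le.trans (P.active_run_antitone router v l.le_succ))
    by_cases hr : (P.greedy router).running v ((P.greedy router).run v l)
    · have hm : P.selected router v ((P.greedy router).run v l) hr.1 ∈
          RoutingState.active ((P.greedy router).run v l) := firstArgmax_mem _
      have he := (P.active_run_succ router hr).symm.trans (h.trans hl.symm)
      exact absurd hm (Finset.erase_eq_self.1 he)
    · rw [run_succ_of_not_running P router hr, ih hl]

/-- A reachable state is determined by its active set and the values of the selected firms. -/
lemma run_eq_run {v w : N → ℝ≥0} {k l : ℕ}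
    (h : RoutingState.active ((P.greedy router).run v k) =
      RoutingState.active ((P.greedy router).run w l))
    (hvw : ∀ j ∉ RoutingState.active ((P.greedy router).run v k), v j = w j) :
    (P.greedy router).run v k = (P.greedy router).run w l := by
  wlog hkl : k ≤ l generalizing v w k l
  · exact (this h.symm (fun j hj => (hvw j (h ▸ hj)).symm) (le_of_not_ge hkl)).symm
  have hk := P.run_eq_run_of_subset router hvw k Finset.Subset.rfl
    (h.le.trans (P.active_run_antitone router w hkl))
  rw [hk, P.run_eq_of_active_eq router w hkl (by rw [← h, hk])]

/-- The state `σ` is reached, with active set `A`, by a run on some values that extend `u`. -/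
def Reaches (A : Finset N) (u : {j : N // j ∉ A} → ℝ≥0) (σ : RoutingState N E) : Prop :=
  ∃ (v : N → ℝ≥0) (k : ℕ), σ = (P.greedy router).run v k ∧ σ.active = A ∧ ∀ j, u j = v j

variable {P router} in
lemma Reaches.unique {A : Finset N} {u : {j : N // j ∉ A} → ℝ≥0} {σ σ' : RoutingState N E}
    (h : P.Reaches router A u σ) (h' : P.Reaches router A u σ') : σ = σ' := by
  obtain ⟨v, k, rfl, hA, hu⟩ := h
  obtain ⟨w, l, rfl, hA', hu'⟩ := h'
  refine P.run_eq_run router (hA.trans hA'.symm) fun j hj => ?_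
  rw [hA] at hj
  exact (hu ⟨j, hj⟩).symm.trans (hu' ⟨j, hj⟩)

open Classical in
/-- The scores of the greedy algorithm: the quotient at the state with active set `A` that is reached
from values extending `u`, and `0` if there is no such state or the loop has ended there. -/
noncomputable def greedyScore : ScoringFamily N := fun A i b u =>
  if h : ∃ σ, P.Reaches router A u σ ∧ σ.active.Nonempty ∧ ∑ e, P.cap e * σ.dual e < P.threshold
  then P.ratio router h.choose.dual i b else 0

lemma ratio_mono (y : E → ℝ) (i : N) : Monotone (P.ratio router y i) := fun _ _ h =>
  ENNReal.div_le_div_right (ENNReal.coe_le_coe.2 h) _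

lemma ratio_eq_zero_iff {y : E → ℝ} {i : N} {b : ℝ≥0} : P.ratio router y i b = 0 ↔ b = 0 := by
  simp [ratio, ENNReal.div_eq_zero_iff]

lemma greedyScore_mono (A : Finset N) (i : N) (u : {j : N // j ∉ A} → ℝ≥0) :
    Monotone fun b => P.greedyScore router A i b u := by
  intro b b' h
  simp only [greedyScore]
  split_ifs
  · exact P.ratio_mono router _ _ h
  · exact le_rfl

lemma greedyScore_isGreedyScoring : P.IsGreedyScoring router (P.greedyScore router) := by
  intro v k σ hσ i _ b
  have hreach : P.Reaches router σ.active (fun j => v j) σ := ⟨v, k, hσ, rfl, fun _ => rfl⟩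
  by_cases hr : (P.greedy router).running v σ
  · have hex : ∃ τ, P.Reaches router σ.active (fun j => v j) τ ∧ τ.active.Nonempty ∧
        ∑ e, P.cap e * τ.dual e < P.threshold := ⟨σ, hreach, hr⟩
    rw [if_pos hr, greedyScore, dif_pos hex, hex.choose_spec.1.unique hreach]
  · rw [if_neg hr, greedyScore, dif_neg]
    rintro ⟨τ, hτ, hτr⟩
    exact hr (hτ.unique hreach ▸ hτr)

lemma greedyScore_implements : DAImplements (P.greedyScore router) (P.greedy router) := by
  refine ⟨P.greedyScore_mono router, rfl, fun w k => ?_⟩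
  have hs := P.greedyScore_isGreedyScoring router w k _ rfl
  refine ⟨fun hr => ⟨hr.1, ?_⟩, fun hr i hi => ?_, fun h => ?_⟩
  · refine (P.active_run_succ router hr).trans ?_
    congr 1
    refine firstArgmax_congr _ fun i hi => ?_
    exact ((hs i hi (w i)).trans (if_pos hr)).symm
  · exact (hs i hi (w i)).trans (if_neg hr)
  · refine or_iff_not_imp_left.2 fun hr i hi => ?_
    rw [not_not] at hr
    exact (P.ratio_eq_zero_iff router).1 (((hs i hi (w i)).trans (if_pos hr)).symm.trans (h i hi))

end Run

/-! ### Feasibility -/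

lemma minCap_le (P : RoutingProblem N E) (e : E) : P.minCap ≤ P.cap e :=
  ciInf_le (Set.finite_range P.cap).bddBelow e

lemma nonempty_of_one_lt_minCap {P : RoutingProblem N E} (hC : 1 < P.minCap) : Nonempty E := by
  by_contra h
  rw [not_nonempty_iff] at h
  rw [minCap, Real.iInf_of_isEmpty] at hC
  linarith

lemma one_lt_threshold {P : RoutingProblem N E} (hC : 1 < P.minCap) : 1 < P.threshold := by
  have := nonempty_of_one_lt_minCap hC
  have hm : (1 : ℝ) ≤ Fintype.card E := by exact_mod_cast Fintype.card_pos
  have he : 1 < Real.exp (P.minCap - 1) := Real.one_lt_exp_iff.2 (by linarith)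
  rw [threshold]
  nlinarith

/-- `τ ^ (1 / (C - 1)) = ē m ^ (1 / (C - 1))` for the threshold `τ`. -/
lemma threshold_rpow {P : RoutingProblem N E} (hC : 1 < P.minCap) :
    P.threshold ^ (1 / (P.minCap - 1)) =
      Real.exp 1 * (Fintype.card E : ℝ) ^ (1 / (P.minCap - 1)) := by
  rw [threshold, Real.mul_rpow (Real.exp_pos _).le (Nat.cast_nonneg _), ← Real.exp_mul,
    mul_one_div_cancel (by linarith)]

/-- The load that the solution held by the state `σ` puts on the edge `e`. -/
noncomputable def load [Fintype N] [DecidableEq N] (P : RoutingProblem N E)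
    (σ : RoutingState N E) (e : E) : ℝ :=
  ∑ i ∈ σ.activeᶜ with e ∈ σ.route i, P.demand i

/-- The selected firms have admissible routes within the capacities, and the dual variables record
the loads. -/
structure Invariant [Fintype N] [DecidableEq N] (P : RoutingProblem N E)
    (σ : RoutingState N E) : Prop where
  route_mem : ∀ i ∉ σ.active, σ.route i ∈ P.routes i
  load_le : ∀ e, P.load σ e ≤ P.cap e
  dual_eq : ∀ e, P.cap e * σ.dual e = P.threshold ^ (P.load σ e / (P.cap e - 1))

section Feasible

variable [Fintype N] [LinearOrder N] {P : RoutingProblem N E} {router : N → (E → ℝ) → Finset E}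

lemma Invariant.dual_pos (hC : 1 < P.minCap) {σ : RoutingState N E} (h : P.Invariant σ) (e : E) :
    0 < σ.dual e := by
  have hc : 0 < P.cap e := by linarith [P.minCap_le e]
  have h1 : 0 < P.cap e * σ.dual e := by
    rw [h.dual_eq e]
    exact Real.rpow_pos_of_pos (by linarith [one_lt_threshold hC]) _
  exact (mul_pos_iff_of_pos_left hc).1 h1

lemma load_select {σ : RoutingState N E} {i : N} (hi : i ∈ σ.active) (e : E) :
    P.load (P.select router σ i) e =
      P.load σ e + if e ∈ router i σ.dual then P.demand i else 0 := by
  have hi' : i ∉ σ.activeᶜ := by simpa using hi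
  simp only [load, select, Finset.compl_erase, Finset.sum_filter]
  rw [Finset.sum_insert hi', Function.update_self, add_comm]
  congr 1
  refine Finset.sum_congr rfl fun j hj => ?_
  rw [Function.update_of_ne (by rintro rfl; exact hi' hj)]

/-- If the loop is running then every load is less than `c(e) - 1`. -/
lemma Invariant.load_lt (hC : 1 < P.minCap) {σ : RoutingState N E} (h : P.Invariant σ)
    (hr : ∑ e, P.cap e * σ.dual e < P.threshold) (e : E) : P.load σ e < P.cap e - 1 := by
  have hτ := one_lt_threshold hC
  have hc : 0 < P.cap e - 1 := by linarith [P.minCap_le e]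
  have h1 : P.cap e * σ.dual e ≤ ∑ e, P.cap e * σ.dual e :=
    Finset.single_le_sum (f := fun e => P.cap e * σ.dual e)
      (fun e _ => mul_nonneg (by linarith [P.minCap_le e]) (h.dual_pos hC e).le)
      (Finset.mem_univ e)
  have h2 : P.threshold ^ (P.load σ e / (P.cap e - 1)) < P.threshold ^ (1 : ℝ) := by
    rw [← h.dual_eq e, Real.rpow_one]
    exact h1.trans_lt hr
  rw [Real.rpow_lt_rpow_left_iff hτ, div_lt_one hc] at h2
  exact h2

lemma Invariant.select {γ : ℝ} (hd : ∀ i, P.demand i ≤ 1) (hC : 1 < P.minCap)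
    (hrouter : P.IsRouter γ router) {σ : RoutingState N E} (h : P.Invariant σ)
    (hr : ∑ e, P.cap e * σ.dual e < P.threshold) {i : N} (hi : i ∈ σ.active) :
    P.Invariant (P.select router σ i) where
  route_mem j hj := by
    by_cases hji : j = i
    · subst hji
      simp only [RoutingProblem.select, Function.update_self]
      exact (hrouter j _ (h.dual_pos hC)).1
    · simp only [RoutingProblem.select, Finset.mem_erase, not_and] at hj ⊢
      rw [Function.update_of_ne hji]
      exact h.route_mem j (hj hji)
  load_le e := by
    have := h.load_lt hC hr e
    rw [load_select hi]
    split_ifs <;> linarith [hd i]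
  dual_eq e := by
    rw [load_select hi]
    simp only [RoutingProblem.select, updateDual]
    split_ifs
    · rw [← mul_assoc, h.dual_eq e, add_div,
        Real.rpow_add (by linarith [one_lt_threshold hC])]
    · rw [h.dual_eq e, add_zero]

lemma invariant_run {γ : ℝ} (hd : ∀ i, P.demand i ≤ 1) (hC : 1 < P.minCap)
    (hrouter : P.IsRouter γ router) (v : N → ℝ≥0) (k : ℕ) :
    P.Invariant ((P.greedy router).run v k) := by
  induction k with
  | zero =>
    have hc (e : E) : 0 < P.cap e := by linarith [P.minCap_le e]
    refine ⟨fun i hi => absurd (Finset.mem_univ i) hi, fun e => ?_, fun e => ?_⟩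
    · simpa [GreedyAlgorithm.run, greedy, load] using (hc e).le
    · simp [GreedyAlgorithm.run, greedy, load, (hc e).ne']
  | succ k ih =>
    by_cases h : (P.greedy router).running v ((P.greedy router).run v k)
    · rw [run_succ_of_running P router h]
      exact ih.select hd hC hrouter h.2 (firstArgmax_mem _)
    · rwa [run_succ_of_not_running P router h]

lemma Invariant.isFeasible {σ : RoutingState N E} (h : P.Invariant σ) :
    P.IsFeasible σ.activeᶜ σ.route :=
  ⟨fun i hi => h.route_mem i (Finset.mem_compl.1 hi), h.load_le⟩

end Feasible

/-! ### Growth of the dual objective -/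

section Growth

variable {P : RoutingProblem N E} {router : N → (E → ℝ) → Finset E}

/-- The factor `κ = C (τ ^ (1 / (C - 1)) - 1)` in the bound on the growth of `∑ c(e) y(e)`. -/
noncomputable def growth (P : RoutingProblem N E) : ℝ :=
  P.minCap * (P.threshold ^ (1 / (P.minCap - 1)) - 1)

lemma growth_nonneg (hC : 1 < P.minCap) : 0 ≤ P.growth :=
  mul_nonneg (by linarith) (sub_nonneg.2 (Real.one_le_rpow (one_lt_threshold hC).le
    (one_div_nonneg.2 (by linarith))))

/-- Bernoulli's inequality for the exponent `p = d (C - 1) / (c - 1) ∈ [0, 1]`, together with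
`c / (c - 1) ≤ C / (C - 1)`. -/
lemma cap_mul_rpow_sub_one_le (hC : 1 < P.minCap) {d : ℝ} (hd0 : 0 ≤ d) (hd1 : d ≤ 1) (e : E) :
    P.cap e * (P.threshold ^ (d / (P.cap e - 1)) - 1) ≤ P.growth * d := by
  have hτ := one_lt_threshold hC
  have hCc := P.minCap_le e
  have hC0 : 0 < P.minCap - 1 := by linarith
  have hc0 : 0 < P.cap e - 1 := by linarith
  set p := d * (P.minCap - 1) / (P.cap e - 1) with hp
  set t := P.threshold ^ (1 / (P.minCap - 1)) with ht
  have ht1 : 1 ≤ t := Real.one_le_rpow hτ.le (one_div_nonneg.2 hC0.le)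
  have hp0 : 0 ≤ p := by positivity
  have hp1 : p ≤ 1 := by
    rw [hp, div_le_one hc0]
    nlinarith
  have hpow : P.threshold ^ (d / (P.cap e - 1)) = (1 + (t - 1)) ^ p := by
    rw [add_sub_cancel, ht, ← Real.rpow_mul (by linarith)]
    congr 1
    rw [hp]
    field_simp
  have hB : (1 + (t - 1)) ^ p ≤ 1 + p * (t - 1) :=
    rpow_one_add_le_one_add_mul_self (by linarith) hp0 hp1
  have hcp : P.cap e * p ≤ P.minCap * d := by
    rw [hp, ← mul_div_assoc, div_le_iff₀ hc0]
    nlinarith [mul_nonneg hd0 (sub_nonneg.2 hCc)]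
  calc P.cap e * (P.threshold ^ (d / (P.cap e - 1)) - 1)
      ≤ P.cap e * (p * (t - 1)) := by
        rw [hpow]
        exact mul_le_mul_of_nonneg_left (by linarith) (by linarith)
    _ = P.cap e * p * (t - 1) := by ring
    _ ≤ P.minCap * d * (t - 1) := mul_le_mul_of_nonneg_right hcp (by linarith)
    _ = P.growth * d := by rw [growth]; ring

lemma sum_updateDual_le (hC : 1 < P.minCap) {i : N} (hd : 0 ≤ P.demand i ∧ P.demand i ≤ 1)
    {y : E → ℝ} (hy : ∀ e, 0 < y e) (S : Finset E) :
    ∑ e, P.cap e * P.updateDual y i S e ≤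
      ∑ e, P.cap e * y e + P.growth * (P.demand i * ∑ e ∈ S, y e) := by
  have hS : ∑ e ∈ S, y e = ∑ e, if e ∈ S then y e else 0 := by
    rw [Finset.sum_ite_mem, Finset.univ_inter]
  rw [hS, Finset.mul_sum, Finset.mul_sum, ← Finset.sum_add_distrib]
  refine Finset.sum_le_sum fun e _ => ?_
  rw [updateDual]
  split_ifs
  · have := mul_le_mul_of_nonneg_right (cap_mul_rpow_sub_one_le hC hd.1 hd.2 e) (hy e).le
    linarith
  · simp

/-- The maximality of the selected quotient, with the denominators cleared. -/
lemma mul_le_mul_of_ratio_le {y : E → ℝ} {i j : N} {a b : ℝ≥0}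
    (hi : 0 ≤ P.demand i * ∑ e ∈ router i y, y e)
    (hj : 0 ≤ P.demand j * ∑ e ∈ router j y, y e)
    (h : P.ratio router y j b ≤ P.ratio router y i a) :
    (b : ℝ) * (P.demand i * ∑ e ∈ router i y, y e) ≤
      a * (P.demand j * ∑ e ∈ router j y, y e) := by
  simp only [ratio] at h
  generalize P.demand i * ∑ e ∈ router i y, y e = x at *
  generalize P.demand j * ∑ e ∈ router j y, y e = z at *
  lift x to ℝ≥0 using hi
  lift z to ℝ≥0 using hj
  simp only [ENNReal.ofReal_coe_nnreal] at h
  rcases eq_or_ne x 0 with rfl | hx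
  · simpa using by positivity
  rcases eq_or_ne z 0 with rfl | hz
  · rcases eq_or_ne b 0 with rfl | hb
    · simp
    · -- a positive number over `0` is `∞`, which is not at most a finite quotient
      rw [ENNReal.coe_zero, ENNReal.div_zero (by simpa using hb), top_le_iff,
        ← ENNReal.coe_div hx] at h
      exact absurd h ENNReal.coe_ne_top
  rw [← ENNReal.coe_div hx, ← ENNReal.coe_div hz, ENNReal.coe_le_coe,
    div_le_div_iff₀ (pos_iff_ne_zero.2 hz) (pos_iff_ne_zero.2 hx)] at h
  exact_mod_cast h

/-- Weak duality: routing a feasible set by a `γ`-approximate router costs at most `γ ∑ c(e) y(e)`. -/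
lemma sum_demand_mul_le {γ : ℝ} (hγ : 0 ≤ γ) (hd : ∀ i, 0 ≤ P.demand i)
    (hrouter : P.IsRouter γ router) {y : E → ℝ} (hy : ∀ e, 0 < y e) {R : Finset N}
    {T : N → Finset E} (hR : P.IsFeasible R T) :
    ∑ j ∈ R, P.demand j * ∑ e ∈ router j y, y e ≤ γ * ∑ e, P.cap e * y e := by
  calc ∑ j ∈ R, P.demand j * ∑ e ∈ router j y, y e
      ≤ ∑ j ∈ R, P.demand j * (γ * ∑ e ∈ T j, y e) :=
        Finset.sum_le_sum fun j hj =>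
          mul_le_mul_of_nonneg_left ((hrouter j y hy).2 _ (hR.1 j hj)) (hd j)
    _ = γ * ∑ e, (∑ j ∈ R with e ∈ T j, P.demand j) * y e := by
        simp only [Finset.sum_filter, Finset.sum_mul]
        rw [Finset.sum_comm, Finset.mul_sum]
        refine Finset.sum_congr rfl fun j _ => ?_
        rw [mul_left_comm, Finset.mul_sum]
        congr 1
        simp [ite_mul, Finset.sum_ite_mem]
    _ ≤ γ * ∑ e, P.cap e * y e :=
        mul_le_mul_of_nonneg_left (Finset.sum_le_sum fun e _ =>
          mul_le_mul_of_nonneg_right (hR.2 e) (hy e).le) hγ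

lemma IsFeasible.mono (hd : ∀ i, 0 ≤ P.demand i) {R R' : Finset N} {T : N → Finset E}
    (h : P.IsFeasible R T) (hR : R' ⊆ R) : P.IsFeasible R' T :=
  ⟨fun i hi => h.1 i (hR hi), fun e => (Finset.sum_le_sum_of_subset_of_nonneg
    (Finset.filter_subset_filter _ hR) fun i _ _ => hd i).trans (h.2 e)⟩

/-- One iteration of the primal-dual argument: if the firm `i` has the highest quotient among the
firms of a feasible set `R`, then selecting it increases `D = ∑ c(e) y(e)` by at most
`κ γ v(i) D / ∑_{j ∈ R} v(j)`. -/
lemma value_mul_dual_increase_le {γ : ℝ} (hγ : 0 ≤ γ)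
    (hd : ∀ i, 0 ≤ P.demand i ∧ P.demand i ≤ 1) (hC : 1 < P.minCap)
    (hrouter : P.IsRouter γ router) {y : E → ℝ} (hy : ∀ e, 0 < y e) {R : Finset N}
    {T : N → Finset E} (hR : P.IsFeasible R T) {v : N → ℝ≥0} {i : N}
    (hi : ∀ j ∈ R, P.ratio router y j (v j) ≤ P.ratio router y i (v i)) :
    (∑ j ∈ R, (v j : ℝ)) *
        (∑ e, P.cap e * P.updateDual y i (router i y) e - ∑ e, P.cap e * y e) ≤
      P.growth * γ * v i * ∑ e, P.cap e * y e := by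
  have hnn (j : N) : 0 ≤ P.demand j * ∑ e ∈ router j y, y e :=
    mul_nonneg (hd j).1 (Finset.sum_nonneg fun e _ => (hy e).le)
  have hκ := growth_nonneg hC
  have hinc := sum_updateDual_le hC (hd i) hy (router i y)
  calc _ ≤ (∑ j ∈ R, (v j : ℝ)) * (P.growth * (P.demand i * ∑ e ∈ router i y, y e)) :=
        mul_le_mul_of_nonneg_left (by linarith) (by positivity)
    _ = P.growth * ∑ j ∈ R, (v j : ℝ) * (P.demand i * ∑ e ∈ router i y, y e) := by
        rw [← Finset.sum_mul]; ring
    _ ≤ P.growth * ∑ j ∈ R, (v i : ℝ) * (P.demand j * ∑ e ∈ router j y, y e) :=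
        mul_le_mul_of_nonneg_left (Finset.sum_le_sum fun j hj =>
          mul_le_mul_of_ratio_le (hnn i) (hnn j) (hi j hj)) hκ
    _ = P.growth * v i * ∑ j ∈ R, P.demand j * ∑ e ∈ router j y, y e := by
        rw [← Finset.mul_sum]; ring
    _ ≤ P.growth * v i * (γ * ∑ e, P.cap e * y e) :=
        mul_le_mul_of_nonneg_left (sum_demand_mul_le hγ (fun j => (hd j).1) hrouter hy hR)
          (by positivity)
    _ = _ := by ring

end Growth

/-! ### The approximation guarantee -/

section Approximation

variable [Fintype N] [LinearOrder N] {P : RoutingProblem N E} {router : N → (E → ℝ) → Finset E}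
  {γ : ℝ}

lemma le_mul_exp_of_mul_sub_le {a b Δ S D D' m x : ℝ} (ha : 0 ≤ a) (hD : 0 ≤ D) (hb : 0 ≤ b)
    (hΔ : 0 < Δ) (hS : Δ ≤ S) (hstep : S * (D' - D) ≤ a * b * D)
    (h : D ≤ m * Real.exp (a / Δ * x)) : D' ≤ m * Real.exp (a / Δ * (b + x)) := by
  have h1 : Δ * (D' - D) ≤ a * b * D := by
    rcases le_total D D' with hle | hle
    · exact (mul_le_mul_of_nonneg_right hS (sub_nonneg.2 hle)).trans hstep
    · exact (mul_nonpos_of_nonneg_of_nonpos hΔ.le (sub_nonpos.2 hle)).trans (by positivity)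
  have h2 : D' ≤ D * (a / Δ * b + 1) := by
    have : D' - D ≤ a * b * D / Δ := by rwa [le_div_iff₀ hΔ, mul_comm]
    calc D' ≤ a * b * D / Δ + D := by linarith
      _ = _ := by ring
  calc D' ≤ D * (a / Δ * b + 1) := h2
    _ ≤ D * Real.exp (a / Δ * b) := mul_le_mul_of_nonneg_left (Real.add_one_le_exp _) hD
    _ ≤ m * Real.exp (a / Δ * x) * Real.exp (a / Δ * b) :=
      mul_le_mul_of_nonneg_right h (Real.exp_pos _).le
    _ = m * Real.exp (a / Δ * (b + x)) := by
      rw [mul_assoc, ← Real.exp_add, mul_add, add_comm]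

/-- If the firms of the feasible set `R` not selected in `k` rounds have total value at least `Δ`,
then `∑ c(e) y(e) ≤ m exp (κ γ value / Δ)` after these rounds. -/
lemma dual_le_exp (hγ : 0 ≤ γ) (hd : ∀ i, 0 ≤ P.demand i ∧ P.demand i ≤ 1)
    (hC : 1 < P.minCap) (hrouter : P.IsRouter γ router) {R : Finset N} {T : N → Finset E}
    (hR : P.IsFeasible R T) (v : N → ℝ≥0) {Δ : ℝ} (hΔ : 0 < Δ) (k : ℕ)
    (h : Δ ≤ ∑ j ∈ R ∩ RoutingState.active ((P.greedy router).run v k), (v j : ℝ)) :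
    ∑ e, P.cap e * RoutingState.dual ((P.greedy router).run v k) e ≤
      Fintype.card E * Real.exp (P.growth * γ / Δ *
        ∑ j ∈ (RoutingState.active ((P.greedy router).run v k))ᶜ, (v j : ℝ)) := by
  induction k with
  | zero =>
    have hc (e : E) : P.cap e * (1 / P.cap e) = 1 :=
      mul_one_div_cancel (by linarith [P.minCap_le e])
    simp only [GreedyAlgorithm.run, greedy, Function.iterate_zero, id_eq, hc]
    simp
  | succ k ih =>
    have hk := h.trans (Finset.sum_le_sum_of_subset_of_nonneg
      (Finset.inter_subset_inter_left (P.active_run_antitone router v k.le_succ))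
      fun _ _ _ => NNReal.coe_nonneg _)
    have ih := ih hk
    by_cases hr : (P.greedy router).running v ((P.greedy router).run v k)
    · have hy := (invariant_run (fun i => (hd i).2) hC hrouter v k).dual_pos hC
      have hi : P.selected router v ((P.greedy router).run v k) hr.1 ∈
          RoutingState.active ((P.greedy router).run v k) := firstArgmax_mem _
      have hstep := value_mul_dual_increase_le hγ hd hC hrouter hy
        (hR.mono (fun i => (hd i).1) Finset.inter_subset_left)
        (fun j hj => le_firstArgmax (f := fun i => P.ratio router _ i (v i)) hr.1
          (Finset.mem_inter.1 hj).2)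
      have hD : 0 ≤ ∑ e, P.cap e * RoutingState.dual ((P.greedy router).run v k) e :=
        Finset.sum_nonneg fun e _ => mul_nonneg (by linarith [P.minCap_le e]) (hy e).le
      have hsum := Finset.sum_insert (f := fun j => (v j : ℝ))
        (fun hm => Finset.mem_compl.1 hm hi)
      rw [run_succ_of_running P router hr]
      simp only [RoutingProblem.select, Finset.compl_erase]
      rw [hsum]
      exact le_mul_exp_of_mul_sub_le (mul_nonneg (growth_nonneg hC) hγ) hD
        (NNReal.coe_nonneg _) hΔ hk hstep ih
    · rwa [run_succ_of_not_running P router hr]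

/-- If the loop has ended because the threshold was reached, the value of a feasible set exceeds the
value of the returned one by at most `κ γ / (C - 1)` times the latter. -/
lemma mul_value_le_of_threshold_le (hγ : 0 ≤ γ) (hd : ∀ i, 0 ≤ P.demand i ∧ P.demand i ≤ 1)
    (hC : 1 < P.minCap) (hrouter : P.IsRouter γ router) {R : Finset N} {T : N → Finset E}
    (hR : P.IsFeasible R T) (v : N → ℝ≥0) (k : ℕ)
    (h : P.threshold ≤ ∑ e, P.cap e * RoutingState.dual ((P.greedy router).run v k) e) :
    (P.minCap - 1) * (∑ j ∈ R, (v j : ℝ) -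
        ∑ j ∈ (RoutingState.active ((P.greedy router).run v k))ᶜ, (v j : ℝ)) ≤
      P.growth * γ * ∑ j ∈ (RoutingState.active ((P.greedy router).run v k))ᶜ, (v j : ℝ) := by
  have hκ := growth_nonneg hC
  have hC0 : 0 < P.minCap - 1 := by linarith
  set A := RoutingState.active ((P.greedy router).run v k) with hA
  have hval : 0 ≤ ∑ j ∈ Aᶜ, (v j : ℝ) := by positivity
  rcases le_or_gt (∑ j ∈ R, (v j : ℝ)) (∑ j ∈ Aᶜ, (v j : ℝ)) with hle | hlt
  · exact (mul_nonpos_of_nonneg_of_nonpos hC0.le (sub_nonpos.2 hle)).trans (by positivity)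
  have hΔ := sub_pos.2 hlt
  have hrest : ∑ j ∈ R, (v j : ℝ) - ∑ j ∈ Aᶜ, (v j : ℝ) ≤ ∑ j ∈ R ∩ A, (v j : ℝ) := by
    have hsub : ∑ j ∈ R \ A, (v j : ℝ) ≤ ∑ j ∈ Aᶜ, (v j : ℝ) :=
      Finset.sum_le_sum_of_subset_of_nonneg
        (fun j hj => Finset.mem_compl.2 (Finset.mem_sdiff.1 hj).2)
        fun _ _ _ => NNReal.coe_nonneg _
    linarith [Finset.sum_inter_add_sum_sdiff R A fun j => (v j : ℝ)]
  have hD := h.trans (dual_le_exp hγ hd hC hrouter hR v hΔ k hrest)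
  have := nonempty_of_one_lt_minCap hC
  have hm : (0 : ℝ) < Fintype.card E := by exact_mod_cast Fintype.card_pos
  rw [threshold, mul_comm, mul_le_mul_iff_right₀ hm, Real.exp_le_exp, ← hA,
    div_mul_eq_mul_div, le_div_iff₀ hΔ] at hD
  exact hD

theorem greedyApproximates (hγ : 1 ≤ γ) (hd : ∀ i, 0 ≤ P.demand i ∧ P.demand i ≤ 1)
    (hC : 1 < P.minCap) (hrouter : P.IsRouter γ router) :
    P.GreedyApproximates router (P.approxRatio γ) := by
  intro v
  refine ⟨Fintype.card N, _, le_rfl, rfl, P.not_running_card router v,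
    (invariant_run (fun i => (hd i).2) hC hrouter v _).isFeasible, fun R T hR => ?_⟩
  have hended := P.not_running_card router v
  have hend := mul_value_le_of_threshold_le (by linarith) hd hC hrouter hR v (Fintype.card N)
  set σ : RoutingState N E := (P.greedy router).run v (Fintype.card N)
  have hC0 : 0 < P.minCap - 1 := by linarith
  have hval : 0 ≤ ∑ j ∈ σ.activeᶜ, (v j : ℝ) := by positivity
  have hCγ : P.minCap - 1 ≤ P.minCap * γ := by nlinarith
  set t := Real.exp 1 * (Fintype.card E : ℝ) ^ (1 / (P.minCap - 1)) with ht
  have ht1 : 1 ≤ t := by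
    rw [ht, ← threshold_rpow hC]
    exact Real.one_le_rpow (one_lt_threshold hC).le (one_div_nonneg.2 hC0.le)
  have hratio : P.approxRatio γ = (P.minCap * γ * t / (P.minCap - 1))⁻¹ := by
    rw [approxRatio, ht]
    congr 1
    ring
  rw [hratio, inv_mul_le_iff₀ (by positivity), div_mul_eq_mul_div, le_div_iff₀ hC0]
  by_cases hne : σ.active.Nonempty
  · have hthr : P.threshold ≤ ∑ e, P.cap e * σ.dual e := not_lt.1 fun hlt => hended ⟨hne, hlt⟩
    have hend := hend hthr
    rw [growth, threshold_rpow hC, ← ht] at hend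
    linarith [mul_le_mul_of_nonneg_right hCγ hval]
  · -- all firms have been selected
    rw [Finset.not_nonempty_iff_eq_empty] at hne
    have hle : ∑ j ∈ R, (v j : ℝ) ≤ ∑ j ∈ σ.activeᶜ, (v j : ℝ) := by
      rw [hne, Finset.compl_empty]
      exact Finset.sum_le_univ_sum_of_nonneg fun _ => NNReal.coe_nonneg _
    have hfac : P.minCap - 1 ≤ P.minCap * γ * t :=
      hCγ.trans (le_mul_of_one_le_right (by positivity) ht1)
    calc _ ≤ (∑ j ∈ σ.activeᶜ, (v j : ℝ)) * (P.minCap - 1) :=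
          mul_le_mul_of_nonneg_right hle hC0.le
      _ ≤ _ := by
          rw [mul_comm]
          exact mul_le_mul_of_nonneg_right hfac hval

end Approximation

end RoutingProblem

end BandwidthAuction

theorem theorem2 {V N : Type*} [Fintype V] [DecidableEq V] [Fintype N] [LinearOrder N]
    (G : SimpleGraph V) [DecidableRel G.Adj] (cap : G.edgeSet → ℝ) (demand : N → ℝ)
    (hdemand : ∀ i, 0 ≤ demand i ∧ demand i ≤ 1) (hcap : 1 < ⨅ e, cap e) :
    (∀ (s t : N → V) (router : N → (G.edgeSet → ℝ) → Finset G.edgeSet),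
      (unicast G cap demand s t).IsRouter 1 router →
        (∃ score : ScoringFamily N,
          (unicast G cap demand s t).IsGreedyScoring router score ∧
          DAImplements score ((unicast G cap demand s t).greedy router)) ∧
        (unicast G cap demand s t).GreedyApproximates router
          ((unicast G cap demand s t).approxRatio 1)) ∧
    (∀ (source : N → V) (sinks : N → Set V)
      (router : N → (G.edgeSet → ℝ) → Finset G.edgeSet),
      (multicast G cap demand source sinks).IsRouter 1.55 router →
        (∃ score : ScoringFamily N,
          (multicast G cap demand source sinks).IsGreedyScoring router score ∧
          DAImplements score ((multicast G cap demand source sinks).greedy router)) ∧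
        (multicast G cap demand source sinks).GreedyApproximates router
          ((multicast G cap demand source sinks).approxRatio 1.55)) := by
  refine ⟨fun s t router hrouter => ?_, fun source sinks router hrouter => ?_⟩
  · exact ⟨⟨_, RoutingProblem.greedyScore_isGreedyScoring _ router,
      RoutingProblem.greedyScore_implements _ router⟩,
      RoutingProblem.greedyApproximates le_rfl hdemand hcap hrouter⟩
  · exact ⟨⟨_, RoutingProblem.greedyScore_isGreedyScoring _ router,
      RoutingProblem.greedyScore_implements _ router⟩,
      RoutingProblem.greedyApproximates (by norm_num) hdemand hcap hrouter⟩
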